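/- For a finite string $w$, the LZ-End factorization of $w$ is the factorization $w = q_1 \cdots q_{z'}$ into non-empty phrases such that, for every $i$, the string $q_i$ without its last letter is the longest prefix of $q_i \cdots q_{z'}$ that occurs as a suffix of $q_1\cdots q_j$ for some $0 \le j < i$; as an exception, the last phrase $q_{z'}$ may itself be a suffix of $q_1 \cdots q_j$ for some $j < z'$. Every string has exactly one such factorization; let $z_{\mathrm{End}}(w)$ be its number of phrases. Let $S_k$ be the $k$-th period-doubling sequence: $S_0 = a$ and $S_k = \varphi(S_{k-1})$ for $k \ge 1$, where $\varphi$ is the morphism with $\varphi(a)=ab$, $\varphi(b)=aa$. Let $\mathcal{K}$ be the set of integers $k \ge 5$ such that the LZ-End phrase of $S_k$ with index $z_{\mathrm{End}}(S_{k-1})$ equals the last LZ-End phrase of $S_{k-1}$, and let $k^*_m$ be the $m$-th smallest element of $\mathcal{K}$ ($m \ge 1$). Theorem. There is a function $f$ from the non-negative integers to the integers such that $z_{\mathrm{End}}(S_k) = 2k - f(k)$ for all $k \ge 0$ and $f(k) = O(\log^* k)$ as $k \to \infty$, where $\log^* k$ is the least number of times the binary logarithm must be applied to $k$ to reach a value at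 most $1$. More precisely, for all $k \ge 5$ and $m \ge 1$, if $k^*_m - 1 \le k \le k^*_{m+1} - 2$, then $f(k) = m+1$. Moreover, all $k^*_m$ exist, $k^*_1 = 5$, and $k^*_m = k^*_{m-1} + \frac{3}{16}\cdot 2^{k^*_{m-1}}$ for $m \ge 2$. -/

import Mathlib

open Asymptotics Filter

/-- `OccursAtPhraseEnd P x`: the string `x` is a suffix of `p₁ ⋯ pⱼ` for some `j ≤ |P|`, where
`P = [p₁, …, p_r]` is a list of phrases (`j = 0` gives the empty string). -/
def OccursAtPhraseEnd {α : Type*} (P : List (List α)) (x : List α) : Prop :=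
  ∃ j, j ≤ P.length ∧ x <:+ (P.take j).flatten

/-- `IsLZEndPhrase P q R`: after the phrases `P`, when the string `q ++ R` remains to be factorized,
`q` is a correct next phrase. Either `q` without its last letter is the longest prefix of
`q ++ R` that occurs as a suffix of `p₁ ⋯ pⱼ` for some `j`, or `q` is the whole remaining
string (so it is the last phrase) and occurs itself as such a suffix. -/
def IsLZEndPhrase {α : Type*} (P : List (List α)) (q R : List α) : Prop :=
  q ≠ [] ∧
    ((OccursAtPhraseEnd P q.dropLast ∧
        ∀ x, x <+: q ++ R → OccursAtPhraseEnd P x → x.length ≤ q.dropLast.length) ∨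
      (R = [] ∧ OccursAtPhraseEnd P q))

/-- `q` is an LZ-End factorization of the string `w`. -/
def IsLZEndFactorization {α : Type*} (w : List α) (q : List (List α)) : Prop :=
  q.flatten = w ∧
    ∀ (i : ℕ) (hi : i < q.length), IsLZEndPhrase (q.take i) q[i] (q.drop (i + 1)).flatten

theorem OccursAtPhraseEnd.nil {α : Type*} (P : List (List α)) : OccursAtPhraseEnd P [] :=
  ⟨0, Nat.zero_le _, List.nil_suffix⟩

theorem IsLZEndPhrase.exists_of_ne_nil {α : Type*} (P : List (List α)) (w : List α) (hw : w ≠ []) :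
    ∃ q R, q ++ R = w ∧ IsLZEndPhrase P q R := by
  classical
  by_cases h : OccursAtPhraseEnd P w
  · exact ⟨w, [], by simp, hw, Or.inr ⟨rfl, h⟩⟩
  · have hex : ∃ l, l ≤ w.length ∧ OccursAtPhraseEnd P (w.take l) :=
      ⟨0, Nat.zero_le _, by simpa using OccursAtPhraseEnd.nil P⟩
    obtain ⟨l, ⟨hl, hocc⟩, hmax⟩ : ∃ l, (l ≤ w.length ∧ OccursAtPhraseEnd P (w.take l)) ∧
        ∀ l', l' ≤ w.length → OccursAtPhraseEnd P (w.take l') → l' ≤ l := by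
      refine ⟨Nat.findGreatest (fun l => OccursAtPhraseEnd P (w.take l)) w.length,
        ⟨Nat.findGreatest_le _, ?_⟩, fun l' h1 h2 => Nat.le_findGreatest h1 h2⟩
      exact Nat.findGreatest_spec (P := fun l => OccursAtPhraseEnd P (w.take l))
        (Nat.zero_le _) (by simpa using OccursAtPhraseEnd.nil P)
    have hlt : l < w.length := by
      rcases Nat.lt_or_ge l w.length with h1 | h1
      · exact h1
      · rw [List.take_of_length_le h1] at hocc
        exact absurd hocc h
    have hdl : (w.take (l + 1)).dropLast = w.take l := by
      rw [List.dropLast_eq_take, List.take_take, List.length_take]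
      congr 1
      omega
    refine ⟨w.take (l + 1), w.drop (l + 1), List.take_append_drop _ _, ?_, Or.inl ⟨?_, ?_⟩⟩
    · intro h0
      have := congrArg List.length h0
      simp at this
      exact hw this
    · rw [hdl]; exact hocc
    · intro x hx hxo
      rw [List.take_append_drop] at hx
      rw [hdl, List.length_take, Nat.min_eq_left hl]
      refine hmax _ hx.length_le ?_
      rwa [← List.prefix_iff_eq_take.mp hx]

theorem IsLZEndPhrase.unique {α : Type*} {P : List (List α)} {q R q' R' : List α}
    (h : IsLZEndPhrase P q R) (h' : IsLZEndPhrase P q' R') (he : q ++ R = q' ++ R') : q = q' := by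
  have key : q.length = q'.length := by
    have p1 : 0 < q.length := List.length_pos_of_ne_nil h.1
    have p2 : 0 < q'.length := List.length_pos_of_ne_nil h'.1
    have hl := congrArg List.length he
    simp only [List.length_append] at hl
    rcases h.2 with ⟨ho, hm⟩ | ⟨hR, ho⟩ <;> rcases h'.2 with ⟨ho', hm'⟩ | ⟨hR', ho'⟩
    · have a1 := hm _ (he ▸ (List.dropLast_prefix q').trans (List.prefix_append _ _)) ho'
      have a2 := hm' _ (he ▸ (List.dropLast_prefix q).trans (List.prefix_append _ _)) ho
      simp only [List.length_dropLast] at a1 a2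
      omega
    · have a1 := hm _ (he ▸ List.prefix_append _ _) ho'
      subst hR'
      simp only [List.length_dropLast, List.length_nil] at a1 hl
      omega
    · have a1 := hm' _ (he ▸ List.prefix_append _ _) ho
      subst hR
      simp only [List.length_dropLast, List.length_nil] at a1 hl
      omega
    · subst hR hR'
      simpa using hl
  exact (List.append_inj he key).1

theorem existsUnique_lzEnd_aux {α : Type*} (n : ℕ) : ∀ (P : List (List α)) (w : List α),
    w.length ≤ n → ∃! q : List (List α), q.flatten = w ∧
      ∀ (i : ℕ) (hi : i < q.length),
        IsLZEndPhrase (P ++ q.take i) q[i] (q.drop (i + 1)).flatten := by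
  have hnil : ∀ (P : List (List α)), ∃! q : List (List α), q.flatten = [] ∧
      ∀ (i : ℕ) (hi : i < q.length),
        IsLZEndPhrase (P ++ q.take i) q[i] (q.drop (i + 1)).flatten := by
    intro P
    refine ⟨[], ⟨rfl, fun i hi => absurd hi (by simp)⟩, ?_⟩
    rintro (_ | ⟨q, qs⟩) ⟨hf, hq⟩
    · rfl
    · have := (hq 0 (by simp)).1
      simp at hf this
      exact absurd hf.1 this
  induction n with
  | zero =>
    intro P w hw
    obtain rfl : w = [] := List.length_eq_zero_iff.mp (by omega)
    exact hnil P
  | succ n ih =>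
    intro P w hw
    by_cases hw0 : w = []
    · subst hw0; exact hnil P
    obtain ⟨q, R, rfl, hq⟩ := IsLZEndPhrase.exists_of_ne_nil P w hw0
    have hpos : 0 < q.length := List.length_pos_of_ne_nil hq.1
    obtain ⟨qs, ⟨hf, hqs⟩, huniq⟩ := ih (P ++ [q]) R (by
      rw [List.length_append] at hw; omega)
    refine ⟨q :: qs, ⟨by simp [hf], ?_⟩, ?_⟩
    · rintro (_ | i) hi
      · simpa [hf] using hq
      · simpa using hqs i (by simpa using hi)
    · rintro (_ | ⟨q', qs'⟩) ⟨hf', hq'⟩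
      · exact absurd hf'.symm hw0
      · have h0 := hq' 0 (by simp)
        simp only [List.take_zero, List.append_nil, List.getElem_cons_zero, Nat.zero_add,
          List.drop_succ_cons, List.drop_zero] at h0
        rw [List.flatten_cons] at hf'
        obtain rfl : q' = q := h0.unique hq hf'
        have hR : qs'.flatten = R := List.append_cancel_left hf'
        rw [huniq qs' ⟨hR, fun i hi => ?_⟩]
        have h2 := hq' (i + 1) (Nat.succ_lt_succ hi)
        rw [List.getElem_cons_succ] at h2
        simpa using h2

/-- Every string has exactly one LZ-End factorization. -/
theorem existsUnique_isLZEndFactorization {α : Type*} (w : List α) :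
    ∃! q, IsLZEndFactorization w q := by
  simpa [IsLZEndFactorization] using existsUnique_lzEnd_aux w.length [] w le_rfl

/-- The LZ-End factorization of `w`, as the list of its phrases. -/
noncomputable def lzEnd {α : Type*} (w : List α) : List (List α) :=
  (existsUnique_isLZEndFactorization w).choose

theorem lzEnd_spec {α : Type*} (w : List α) : IsLZEndFactorization w (lzEnd w) :=
  (existsUnique_isLZEndFactorization w).choose_spec.1

theorem lzEnd_eq {α : Type*} {w : List α} {q : List (List α)} (h : IsLZEndFactorization w q) :
    lzEnd w = q :=
  (existsUnique_isLZEndFactorization w).unique (lzEnd_spec w) h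

/-- The number of phrases of the LZ-End factorization of `w`. -/
noncomputable def lzEndCount {α : Type*} (w : List α) : ℕ := (lzEnd w).length

/-- The binary alphabet `{a, b}`. -/
inductive Letter where
  | a : Letter
  | b : Letter
  deriving DecidableEq

/-- The images of the letters under the period-doubling morphism: `a ↦ ab`, `b ↦ aa`. -/
def pdMorphism : Letter → List Letter
  | Letter.a => [Letter.a, Letter.b]
  | Letter.b => [Letter.a, Letter.a]

/-- The `k`-th period-doubling sequence. -/
def periodDoubling : ℕ → List Letter
  | 0 => [Letter.a]
  | k + 1 => (periodDoubling k).flatMap pdMorphism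

/-- The integers `k ≥ 5` such that, with `z` the number of LZ-End phrases of `S_{k-1}`, the `z`-th
LZ-End phrase of `S_k` exists and equals the last LZ-End phrase of `S_{k-1}`. -/
def lastPhraseKept (k : ℕ) : Prop :=
  5 ≤ k ∧ (lzEnd (periodDoubling k))[lzEndCount (periodDoubling (k - 1)) - 1]? =
    (lzEnd (periodDoubling (k - 1))).getLast?

/-- For `m ≥ 1`, the `m`-th smallest integer `k` satisfying `lastPhraseKept k`. -/
noncomputable def kStar (m : ℕ) : ℕ := Nat.nth lastPhraseKept (m - 1)

theorem exists_iterate_logb_le_one (x : ℝ) : ∃ n : ℕ, (Real.logb 2)^[n] x ≤ 1 := by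
  have key : ∀ (N : ℕ) (x : ℝ), x ≤ N + 1 → ∃ n : ℕ, (Real.logb 2)^[n] x ≤ 1 := by
    intro N
    induction N with
    | zero => intro x hx; exact ⟨0, by simpa using hx⟩
    | succ N ih =>
      intro x hx
      rcases le_or_gt x 2 with h2 | h2
      · rcases le_or_gt x 1 with h1 | h1
        · exact ⟨0, by simpa using h1⟩
        · refine ⟨1, ?_⟩
          simp only [Function.iterate_one]
          rw [Real.logb_le_iff_le_rpow (by norm_num) (by linarith)]
          simpa using h2
      · have hlog : Real.logb 2 x ≤ x - 1 := by
          rw [Real.logb_le_iff_le_rpow (by norm_num) (by linarith)]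
          have := one_add_mul_self_le_rpow_one_add (s := 1) (by norm_num) (p := x - 1)
            (by linarith)
          norm_num at this
          exact this
        obtain ⟨n, hn⟩ := ih (Real.logb 2 x) (by push_cast at hx; linarith)
        exact ⟨n + 1, by simpa using hn⟩
  obtain ⟨N, hN⟩ := exists_nat_ge x
  exact key N x (by linarith)

open Classical in
/-- The iterated logarithm `log* x`: the least number of times that the binary logarithm has to be
applied to `x` to reach a value at most `1`. -/
noncomputable def logStar (x : ℝ) : ℕ := Nat.find (exists_iterate_logb_le_one x)

/-! Letter `j` of the infinite period-doubling word depends only on the parity of the exponent of 2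
in `j`. All `S_k` are prefixes of that word, so their factorizations are cuts at `2 ^ k` of one
greedy parse, recorded by its phrase ends (`LZEndChain`).

The parse runs in cycles. A cycle with parameter `e` starts when the phrases fill `S_{e+3}` exactly.
The next phrase has length `5 * 2 ^ e + 1` and stops `3 * 2 ^ e - 1` letters before the end of
`S_{e+4}`. Each further doubling, from `16 * N` to `32 * N`, takes one phrase of length `4 * N + 1`
and one of length `12 * N`; their total `16 * N + 1` reduces the deficit by one. At deficit zero the
next cycle starts, with parameter `e + 3 * 2 ^ e`. While the deficit is positive, the missing
letters form one extra last phrase; when it vanishes that phrase is saved, so `2k - z` grows by one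
per cycle. Cycle starts grow like a tower of twos, whence `log*`.

Phrases reach their length because shifts by multiples of `2 ^ d` preserve most letters
(`pdLetter_add_two_pow_mul`). They reach no further because a long match fixes its source modulo a
power of 2 (`modEq_of_match`), and the few remaining sources fail at a single letter or end at no
phrase end. -/

/-! ### Letters of the infinite word and rigidity of its windows -/

/-- The other letter. -/
def Letter.flip : Letter → Letter
  | .a => .b
  | .b => .a

theorem Letter.flip_inj {x y : Letter} : x.flip = y.flip ↔ x = y := by
  cases x <;> cases y <;> simp [Letter.flip]

/-- Computes `pdLetter` with a bound on the number of halvings. -/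
def pdLetterAux : ℕ → ℕ → Letter
  | 0, _ => .a
  | f + 1, j => if j % 2 = 1 then .a else (pdLetterAux f (j / 2)).flip

/-- The `j`-th letter (`j ≥ 1`) of the infinite period-doubling word: `a` if and only if the
exponent of `2` in `j` is even. -/
def pdLetter (j : ℕ) : Letter := pdLetterAux j j

theorem pdLetterAux_eq (f : ℕ) : ∀ g j, 0 < j → j ≤ f → j ≤ g →
    pdLetterAux f j = pdLetterAux g j := by
  induction f with
  | zero => intro g j h1 h2; omega
  | succ f ih =>
    rintro (_ | g) j h1 h2 h3
    · omega
    · simp only [pdLetterAux]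
      split_ifs
      · rfl
      · rw [ih g (j / 2) (by omega) (by omega) (by omega)]

theorem pdLetter_odd (j : ℕ) : pdLetter (2 * j + 1) = .a := by
  simp [pdLetter, pdLetterAux]

theorem pdLetter_even (j : ℕ) (hj : 0 < j) : pdLetter (2 * j) = (pdLetter j).flip := by
  obtain ⟨i, rfl⟩ : ∃ i, j = i + 1 := ⟨j - 1, by omega⟩
  show pdLetterAux ((2 * i + 1) + 1) (2 * (i + 1)) = _
  rw [pdLetterAux, if_neg (by omega), show 2 * (i + 1) / 2 = i + 1 by omega,
    pdLetterAux_eq _ (i + 1) (i + 1) (by omega) (by omega) le_rfl]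
  rfl

theorem pdLetter_even_inj {i j : ℕ} (hi : 0 < i) (hj : 0 < j) :
    pdLetter (2 * i) = pdLetter (2 * j) ↔ pdLetter i = pdLetter j := by
  rw [pdLetter_even i hi, pdLetter_even j hj, Letter.flip_inj]

theorem pdLetter_two_pow_mul_inj (d : ℕ) {i j : ℕ} (hi : 0 < i) (hj : 0 < j) :
    pdLetter (2 ^ d * i) = pdLetter (2 ^ d * j) ↔ pdLetter i = pdLetter j := by
  induction d with
  | zero => simp
  | succ d ih =>
    rw [pow_succ', mul_assoc, mul_assoc, pdLetter_even_inj (by positivity) (by positivity), ih]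

/-- The exponent of 2 in `i` is below `d`, so adding a multiple of `2 ^ d` leaves it unchanged. This
produces all the long matches. -/
theorem pdLetter_add_two_pow_mul (d : ℕ) : ∀ i o : ℕ, ¬ 2 ^ d ∣ i →
    pdLetter (i + 2 ^ d * o) = pdLetter i := by
  induction d with
  | zero => intro i o h; simp at h
  | succ d ih =>
    intro i o h
    have e : 2 ^ (d + 1) * o = 2 * (2 ^ d * o) := by rw [pow_succ', mul_assoc]
    rw [e]
    obtain ⟨j, rfl | rfl⟩ := i.even_or_odd'
    · have hj : ¬ 2 ^ d ∣ j := fun h' => h (by rw [pow_succ']; exact mul_dvd_mul_left 2 h')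
      have hpos : 0 < j := Nat.pos_of_ne_zero fun h0 => hj (h0 ▸ dvd_zero _)
      rw [← mul_add, pdLetter_even_inj (by omega) hpos, ih j o hj]
    · rw [show 2 * j + 1 + 2 * (2 ^ d * o) = 2 * (j + 2 ^ d * o) + 1 by ring, pdLetter_odd,
        pdLetter_odd]

theorem pdLetter_consecutive (j : ℕ) : pdLetter j = .a ∨ pdLetter (j + 1) = .a := by
  obtain ⟨i, rfl | rfl⟩ := j.even_or_odd'
  · exact .inr (pdLetter_odd i)
  · exact .inl (pdLetter_odd i)

/-- Odd positions carry only `a`, whereas of two consecutive even positions at least one carries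
`b`. -/
theorem not_three_match {i j : ℕ}
    (h : ∀ s, 1 ≤ s → s ≤ 3 → pdLetter (2 * i + s) = pdLetter (2 * j + 1 + s)) : False := by
  have h1 := h 1 le_rfl (by omega)
  have h3 := h 3 (by omega) le_rfl
  rw [pdLetter_odd, show 2 * j + 1 + 1 = 2 * (j + 1) by ring, pdLetter_even _ (by omega)] at h1
  rw [show 2 * i + 3 = 2 * (i + 1) + 1 by ring, pdLetter_odd,
    show 2 * j + 1 + 3 = 2 * (j + 1 + 1) by ring, pdLetter_even _ (by omega)] at h3
  rcases pdLetter_consecutive (j + 1) with h' | h' <;> simp [h', Letter.flip] at h1 h3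

/-- A window of length `3 * 2 ^ d` of the period-doubling word determines its position
modulo `2 ^ (d + 1)`. -/
theorem modEq_of_match (d : ℕ) : ∀ x y : ℕ,
    (∀ s, 1 ≤ s → s ≤ 3 * 2 ^ d → pdLetter (x + s) = pdLetter (y + s)) →
    x ≡ y [MOD 2 ^ (d + 1)] := by
  have parity : ∀ x y : ℕ, (∀ s, 1 ≤ s → s ≤ 3 → pdLetter (x + s) = pdLetter (y + s)) →
      (∃ i j, x = 2 * i ∧ y = 2 * j) ∨ (∃ i j, x = 2 * i + 1 ∧ y = 2 * j + 1) := by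
    intro x y h
    obtain ⟨i, rfl | rfl⟩ := x.even_or_odd' <;> obtain ⟨j, rfl | rfl⟩ := y.even_or_odd'
    · exact .inl ⟨i, j, rfl, rfl⟩
    · exact (not_three_match h).elim
    · exact (not_three_match fun s h1 h2 => (h s h1 h2).symm).elim
    · exact .inr ⟨i, j, rfl, rfl⟩
  induction d with
  | zero =>
    intro x y h
    rcases parity x y (by simpa using h) with ⟨i, j, rfl, rfl⟩ | ⟨i, j, rfl, rfl⟩ <;>
      simp only [Nat.ModEq, zero_add, pow_one] <;> omega
  | succ d ih =>
    intro x y h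
    have hp : 0 < 2 ^ d := by positivity
    rw [pow_succ'] at h
    rcases parity x y (fun s h1 h2 => h s h1 (by omega)) with ⟨i, j, rfl, rfl⟩ | ⟨i, j, rfl, rfl⟩
    · have := ih i j fun s h1 h2 => by
        have := h (2 * s) (by omega) (by omega)
        rwa [← mul_add, ← mul_add, pdLetter_even_inj (by omega) (by omega)] at this
      rw [pow_succ']
      exact this.mul_left' 2
    · have := ih i j fun s h1 h2 => by
        -- After an odd offset the even positions sit at odd distances; halving them gives a window
        -- of half the length.
        have := h (2 * s - 1) (by omega) (by omega)
        rwa [show 2 * i + 1 + (2 * s - 1) = 2 * (i + s) by omega,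
          show 2 * j + 1 + (2 * s - 1) = 2 * (j + s) by omega,
          pdLetter_even_inj (by omega) (by omega)] at this
      rw [pow_succ' 2 (d + 1)]
      exact (this.mul_left' 2).add_right 1

theorem exists_eq_add_of_match {d x y : ℕ} (hxy : x ≤ y)
    (h : ∀ s, 1 ≤ s → s ≤ 3 * 2 ^ d → pdLetter (x + s) = pdLetter (y + s)) :
    ∃ q, y = x + 2 ^ d * (2 * q) := by
  obtain ⟨q, hq⟩ := (Nat.modEq_iff_dvd' hxy).1 (modEq_of_match d x y h)
  exact ⟨q, by rw [← mul_assoc, ← pow_succ, ← hq]; omega⟩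

/-! ### Segments of the infinite word -/

/-- The first `l` letters of the period-doubling word after position `y`. -/
def pdSegment (y l : ℕ) : List Letter := (List.range l).map fun s => pdLetter (y + s + 1)

@[simp] theorem length_pdSegment (y l : ℕ) : (pdSegment y l).length = l := by simp [pdSegment]

theorem pdSegment_append (y l m : ℕ) :
    pdSegment y l ++ pdSegment (y + l) m = pdSegment y (l + m) := by
  simp [pdSegment, List.range_add, add_assoc, Function.comp_def]

theorem dropLast_pdSegment (y l : ℕ) : (pdSegment y (l + 1)).dropLast = pdSegment y l := by
  simp [pdSegment, List.range_succ]

theorem eq_pdSegment_of_prefix {x : List Letter} {y l : ℕ} (h : x <+: pdSegment y l) :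
    x = pdSegment y x.length := by
  have hl : x.length ≤ l := by simpa using h.length_le
  obtain ⟨m, rfl⟩ := Nat.exists_eq_add_of_le hl
  rw [← pdSegment_append] at h
  obtain ⟨z, hz⟩ := h
  exact (List.append_inj hz (by simp)).1

theorem pdSegment_eq_iff {x y l : ℕ} : pdSegment x l = pdSegment y l ↔
    ∀ s, 1 ≤ s → s ≤ l → pdLetter (x + s) = pdLetter (y + s) := by
  simp only [pdSegment, List.map_inj_left, List.mem_range]
  constructor
  · intro h s h1 h2
    have := h (s - 1) (by omega)
    rwa [show x + (s - 1) + 1 = x + s by omega, show y + (s - 1) + 1 = y + s by omega] at this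
  · intro h s hs
    exact h (s + 1) (by omega) (by omega)

theorem flatMap_pdMorphism_pdSegment (m : ℕ) :
    (pdSegment 0 m).flatMap pdMorphism = pdSegment 0 (2 * m) := by
  have hφ : ∀ x, pdMorphism x = [Letter.a, x.flip] := by intro x; cases x <;> rfl
  induction m with
  | zero => rfl
  | succ m ih =>
    rw [← pdSegment_append, List.flatMap_append, ih, mul_add, ← pdSegment_append]
    congr 1
    simp only [pdSegment, zero_add, List.range_succ, List.range_zero, List.nil_append,
      List.map_cons, List.map_nil, List.cons_append, List.flatMap_cons,
      List.flatMap_nil, hφ, mul_one, add_zero, List.append_nil]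
    rw [pdLetter_odd, show 2 * m + 1 + 1 = 2 * (m + 1) by ring, pdLetter_even _ (by omega)]

theorem periodDoubling_eq_pdSegment (k : ℕ) : periodDoubling k = pdSegment 0 (2 ^ k) := by
  induction k with
  | zero => rfl
  | succ k ih => rw [periodDoubling, ih, flatMap_pdMorphism_pdSegment, pow_succ']

/-! ### The greedy parse as a chain of phrase ends -/

/-- The length-`l` suffix of the length-`p` prefix of the period-doubling word occurs at
position `y`. -/
def SuffixMatch (p y l : ℕ) : Prop :=
  ∃ x, x + l = p ∧ ∀ s, 1 ≤ s → s ≤ l → pdLetter (x + s) = pdLetter (y + s)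

/-- The list consists of `0` and the end positions of the first LZ-End phrases of the infinite
period-doubling word, the latest first. -/
inductive LZEndChain : List ℕ → Prop
  | base : LZEndChain [0]
  | step {y l : ℕ} {L : List ℕ} (h : LZEndChain (y :: L))
      (hocc : ∃ p ∈ y :: L, SuffixMatch p y l)
      (hmax : ∀ p ∈ y :: L, ∀ l', SuffixMatch p y l' → l' ≤ l) :
      LZEndChain ((y + l + 1) :: y :: L)

/-- The phrases with the given end positions. -/
def chainPhrases : List ℕ → List (List Letter)
  | z :: y :: L => chainPhrases (y :: L) ++ [pdSegment y (z - y)]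
  | _ => []

theorem chainPhrases_step (y l : ℕ) (L : List ℕ) : chainPhrases ((y + l + 1) :: y :: L) =
    chainPhrases (y :: L) ++ [pdSegment y (l + 1)] := by
  rw [chainPhrases, show y + l + 1 - y = l + 1 by omega]

theorem LZEndChain.length_chainPhrases {y : ℕ} {L : List ℕ} (h : LZEndChain (y :: L)) :
    (chainPhrases (y :: L)).length = L.length := by
  generalize hM : y :: L = M at h
  induction h generalizing y L with
  | base => obtain ⟨rfl, rfl⟩ := List.cons.inj hM; rfl
  | step h _ _ ih =>
    obtain ⟨rfl, rfl⟩ := List.cons.inj hM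
    rw [chainPhrases_step, List.length_append, ih rfl]
    rfl

theorem LZEndChain.flatten_chainPhrases {y : ℕ} {L : List ℕ} (h : LZEndChain (y :: L)) :
    (chainPhrases (y :: L)).flatten = pdSegment 0 y := by
  generalize hM : y :: L = M at h
  induction h generalizing y L with
  | base => obtain ⟨rfl, rfl⟩ := List.cons.inj hM; rfl
  | @step z l L' h _ _ ih =>
    obtain ⟨rfl, rfl⟩ := List.cons.inj hM
    rw [chainPhrases_step, List.flatten_append, ih rfl, add_assoc, ← pdSegment_append 0 z, zero_add]
    simp

theorem suffix_pdSegment_iff {p y l : ℕ} :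
    pdSegment y l <:+ pdSegment 0 p ↔ SuffixMatch p y l := by
  constructor
  · intro h
    have hl : l ≤ p := by simpa using h.length_le
    obtain ⟨x, rfl⟩ := Nat.exists_eq_add_of_le' hl
    rw [← pdSegment_append, zero_add] at h
    obtain ⟨z, hz⟩ := h
    have := (List.append_inj' hz (by simp)).2
    exact ⟨x, rfl, pdSegment_eq_iff.1 this.symm⟩
  · rintro ⟨x, rfl, h⟩
    rw [← pdSegment_append, zero_add, pdSegment_eq_iff.2 h]
    exact List.suffix_append _ _

theorem occursAtPhraseEnd_append_singleton {α : Type*} {P : List (List α)} {q x : List α} :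
    OccursAtPhraseEnd (P ++ [q]) x ↔ OccursAtPhraseEnd P x ∨ x <:+ P.flatten ++ q := by
  constructor
  · rintro ⟨j, hj, hx⟩
    rw [List.length_append, List.length_singleton] at hj
    rcases Nat.lt_or_ge P.length j with h | h
    · right
      rw [List.take_of_length_le (by simpa using h)] at hx
      simpa using hx
    · left
      rw [List.take_append_of_le_length h] at hx
      exact ⟨j, h, hx⟩
  · rintro (⟨j, hj, hx⟩ | hx)
    · exact ⟨j, by simp; omega, by rwa [List.take_append_of_le_length hj]⟩
    · exact ⟨P.length + 1, by simp, by
        rw [List.take_of_length_le (by simp)]; simpa using hx⟩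

theorem LZEndChain.occursAtPhraseEnd_iff {y : ℕ} {L : List ℕ} (h : LZEndChain (y :: L))
    (z l : ℕ) : OccursAtPhraseEnd (chainPhrases (y :: L)) (pdSegment z l) ↔
      ∃ p ∈ y :: L, SuffixMatch p z l := by
  generalize hM : y :: L = M at h
  induction h generalizing y L with
  | base =>
    obtain ⟨rfl, rfl⟩ := List.cons.inj hM
    simp only [List.mem_singleton, exists_eq_left, ← suffix_pdSegment_iff]
    constructor
    · rintro ⟨j, hj, hx⟩
      simpa [chainPhrases, pdSegment] using hx
    · intro hx
      exact ⟨0, le_rfl, by simpa [pdSegment] using hx⟩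
  | @step y l L h _ _ ih =>
    obtain ⟨rfl, rfl⟩ := List.cons.inj hM
    rw [chainPhrases_step, occursAtPhraseEnd_append_singleton, ih rfl, h.flatten_chainPhrases,
      List.exists_mem_cons_iff (l := y :: L), or_comm, ← suffix_pdSegment_iff, add_assoc,
      ← pdSegment_append 0 y, zero_add]

/-- The phrases `P` are correct LZ-End phrases of `P.flatten ++ R`. -/
def IsLZEndFactorizationUpTo {α : Type*} (P : List (List α)) (R : List α) : Prop :=
  ∀ (i : ℕ) (hi : i < P.length), IsLZEndPhrase (P.take i) P[i] ((P.drop (i + 1)).flatten ++ R)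

theorem IsLZEndFactorizationUpTo.append_singleton {α : Type*} {P : List (List α)} {q R : List α}
    (h : IsLZEndFactorizationUpTo P (q ++ R)) (hq : IsLZEndPhrase P q R) :
    IsLZEndFactorizationUpTo (P ++ [q]) R := by
  intro i hi
  rw [List.length_append, List.length_singleton] at hi
  rcases Nat.lt_or_ge i P.length with h' | h'
  · have := h i h'
    rw [List.take_append_of_le_length h'.le, List.getElem_append_left h',
      List.drop_append_of_le_length h']
    simpa using this
  · obtain rfl : i = P.length := by omega
    simpa using hq

theorem LZEndChain.isLZEndFactorizationUpTo {y : ℕ} {L : List ℕ} (h : LZEndChain (y :: L))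
    (m : ℕ) : IsLZEndFactorizationUpTo (chainPhrases (y :: L)) (pdSegment y m) := by
  generalize hM : y :: L = M at h
  induction h generalizing y L m with
  | base =>
    obtain ⟨rfl, rfl⟩ := List.cons.inj hM
    intro i hi
    simp [chainPhrases] at hi
  | @step y l L h hocc hmax ih =>
    obtain ⟨rfl, rfl⟩ := List.cons.inj hM
    rw [chainPhrases_step]
    have e : pdSegment y (l + 1) ++ pdSegment (y + l + 1) m = pdSegment y (l + 1 + m) := by
      rw [add_assoc y, pdSegment_append]
    refine (e ▸ ih _ rfl).append_singleton ⟨?_, .inl ⟨?_, ?_⟩⟩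
    · exact List.ne_nil_of_length_pos (by simp)
    · rwa [dropLast_pdSegment, h.occursAtPhraseEnd_iff]
    · intro x hx hxo
      rw [e] at hx
      rw [eq_pdSegment_of_prefix hx, h.occursAtPhraseEnd_iff] at hxo
      obtain ⟨p, hp, hm⟩ := hxo
      simpa using hmax p hp _ hm

theorem LZEndChain.lzEnd_eq {y : ℕ} {L : List ℕ} (h : LZEndChain (y :: L)) :
    lzEnd (pdSegment 0 y) = chainPhrases (y :: L) := by
  refine _root_.lzEnd_eq ⟨h.flatten_chainPhrases, fun i hi => ?_⟩
  have := h.isLZEndFactorizationUpTo 0 i hi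
  simpa [pdSegment] using this

/-- If the rest without its last letter occurs at a phrase end, then the rest is the last
phrase. -/
theorem LZEndChain.lzEnd_add {y r : ℕ} {L : List ℕ} (h : LZEndChain (y :: L))
    (hr : ∃ p ∈ y :: L, SuffixMatch p y r) :
    lzEnd (pdSegment 0 (y + (r + 1))) = chainPhrases (y :: L) ++ [pdSegment y (r + 1)] := by
  have hq : IsLZEndPhrase (chainPhrases (y :: L)) (pdSegment y (r + 1)) [] := by
    refine ⟨List.ne_nil_of_length_pos (by simp), ?_⟩
    -- If the whole rest occurs, the exception for the last phrase applies; otherwise length `r` is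
    -- maximal.
    by_cases ho : OccursAtPhraseEnd (chainPhrases (y :: L)) (pdSegment y (r + 1))
    · exact .inr ⟨rfl, ho⟩
    · refine .inl ⟨by rwa [dropLast_pdSegment, h.occursAtPhraseEnd_iff], fun x hx hxo => ?_⟩
      rw [List.append_nil] at hx
      have hle := hx.length_le
      rw [length_pdSegment] at hle
      rw [dropLast_pdSegment, length_pdSegment]
      by_contra hlt
      rw [eq_pdSegment_of_prefix hx, show x.length = r + 1 by omega] at hxo
      exact ho hxo
  have h' := (by simpa using h.isLZEndFactorizationUpTo (r + 1) :
    IsLZEndFactorizationUpTo _ (pdSegment y (r + 1) ++ [])).append_singleton hq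
  refine _root_.lzEnd_eq ⟨?_, fun i hi => by simpa using h' i hi⟩
  rw [List.flatten_append, h.flatten_chainPhrases, ← pdSegment_append 0 y, zero_add]
  simp

/-! ### The three kinds of phrases in a cycle -/

/-- Used to refute matches: cancelling `2 ^ e` leaves two numerals whose letters `decide` compares.
-/
theorem pdLetter_eq_of_match {e x y l i j : ℕ}
    (h : ∀ s, 1 ≤ s → s ≤ l → pdLetter (x + s) = pdLetter (y + s)) (s : ℕ) (h1 : 1 ≤ s)
    (h2 : s ≤ l) (hx : x + s = 2 ^ e * i) (hy : y + s = 2 ^ e * j) : pdLetter i = pdLetter j := by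
  have hi : 0 < i := Nat.pos_of_ne_zero fun h0 => by subst h0; omega
  have hj : 0 < j := Nat.pos_of_ne_zero fun h0 => by subst h0; omega
  have := h s h1 h2
  rwa [hx, hy, pdLetter_two_pow_mul_inj e hi hj] at this

/-- A cycle starts with a phrase of length `5 * 2 ^ e + 1`. -/
theorem LZEndChain.first {e : ℕ} {L : List ℕ}
    (h : LZEndChain (8 * 2 ^ e :: 5 * 2 ^ e :: L)) (hL : ∀ p ∈ L, p ≤ 5 * 2 ^ e) :
    LZEndChain ((13 * 2 ^ e + 1) :: 8 * 2 ^ e :: 5 * 2 ^ e :: L) := by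
  have hpos : 0 < 2 ^ e := by positivity
  have := h.step (l := 5 * 2 ^ e) ⟨5 * 2 ^ e, by simp, 0, by simp, fun s h1 h2 => ?_⟩ ?_
  · convert this using 2; ring
  · have := pdLetter_add_two_pow_mul (e + 3) s 1
      fun hd => by have := Nat.le_of_dvd (by omega) hd; rw [pow_add] at this; omega
    rw [zero_add, ← this]
    congr 1; ring
  · rintro p hp l ⟨x, hx, hm⟩
    by_contra! hl
    have hp' : p = 8 * 2 ^ e ∨ p ≤ 5 * 2 ^ e := by
      rcases List.mem_cons.1 hp with rfl | hp
      · exact .inl rfl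
      rcases List.mem_cons.1 hp with rfl | hp
      · exact .inr le_rfl
      · exact .inr (hL p hp)
    obtain ⟨q, hq⟩ := exists_eq_add_of_match (d := e) (by omega) fun s h1 h2 => hm s h1 (by omega)
    have hq1 : q < 5 := by
      by_contra! hc
      have := Nat.mul_le_mul_left (2 ^ e) hc
      rw [mul_left_comm] at hq
      omega
    -- Length forces `p = 8 * 2 ^ e` and a source `x < 3 * 2 ^ e`, so only `q = 3` and `q = 4`
    -- survive.
    interval_cases q <;> try omega
    · exact absurd (pdLetter_eq_of_match (e := e) (i := 4) (j := 10) hm (2 * 2 ^ e) (by omega)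
        (by omega) (by omega) (by omega)) (by decide)
    · exact absurd (pdLetter_eq_of_match (e := e) (i := 8) (j := 16) hm (8 * 2 ^ e) (by omega)
        (by omega) (by omega) (by omega)) (by decide)

/-- The short phrases inside a cycle have length `4 * 2 ^ e + 1`. -/
theorem LZEndChain.short {e r y : ℕ} {L : List ℕ} (h : LZEndChain (y :: L))
    (hy : y + r = 16 * 2 ^ e) (hr : 1 ≤ r) (hr' : r + 1 ≤ 3 * 2 ^ e) (hL : ∀ p ∈ L, p ≤ y)
    (hgap : ∀ p ∈ L, 8 * 2 ^ e < p + r → 8 * 2 ^ e ≤ p) :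
    LZEndChain ((y + 4 * 2 ^ e + 1) :: y :: L) := by
  have hpos : 0 < 2 ^ e := by positivity
  refine h.step (l := 4 * 2 ^ e) ⟨y, by simp, y - 4 * 2 ^ e, by omega, fun s h1 h2 => ?_⟩ ?_
  -- Only at `s = r` does the shift by `4 * 2 ^ e` meet a multiple of itself: it compares 12 with
  -- 16, whose letters agree.
  · by_cases hs : s = r
    · subst hs
      rw [hy, show y - 4 * 2 ^ e + s = 2 ^ e * 12 by omega, mul_comm 16,
        pdLetter_two_pow_mul_inj e (by omega) (by omega)]
      decide
    · have := pdLetter_add_two_pow_mul (e + 2) (y - 4 * 2 ^ e + s) 1 fun ⟨k, hk⟩ => by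
        rw [pow_add, mul_assoc, mul_left_comm] at hk
        have h3 : 2 < k := by
          by_contra! hc
          have := Nat.mul_le_mul_left (2 ^ e) hc
          interval_cases k <;> omega
        have h4 : k < 4 := by
          by_contra! hc
          have := Nat.mul_le_mul_left (2 ^ e) hc
          omega
        obtain rfl : k = 3 := by omega
        omega
      rw [← this]
      congr 1
      rw [pow_add]
      omega
  · rintro p hp l ⟨x, hx, hm⟩
    by_contra! hl
    have hpy : p ≤ y := by
      rcases List.mem_cons.1 hp with rfl | hp
      · exact le_rfl
      · exact hL p hp
    have hgap' : 8 * 2 ^ e < p + r → 8 * 2 ^ e ≤ p := by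
      rcases List.mem_cons.1 hp with rfl | hp
      · omega
      · exact hgap p hp
    obtain ⟨q, hq⟩ := exists_eq_add_of_match (d := e) (by omega) fun s h1 h2 => hm s h1 (by omega)
    have hq1 : q < 8 := by
      by_contra! hc
      have := Nat.mul_le_mul_left (2 ^ e) hc
      rw [mul_left_comm] at hq
      omega
    have key : ∀ i, x + r = 2 ^ e * i → pdLetter i = pdLetter 16 := fun i hi =>
      pdLetter_eq_of_match hm r hr (by omega) hi (by omega)
    -- For `q ≤ 2` the source would end beyond `y`. The letter at distance `r` excludes the others
    -- except `q = 6`.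
    interval_cases q <;> try omega
    · exact absurd (key 10 (by omega)) (by decide)
    · exact absurd (key 8 (by omega)) (by decide)
    · exact absurd (key 6 (by omega)) (by decide)
    -- A shorter match would end strictly between `8 * 2 ^ e - r` and `8 * 2 ^ e`, where `hgap`
    -- allows no phrase end.
    · rcases Nat.lt_or_ge l (4 * 2 ^ e + r) with h' | h'
      · omega
      · exact absurd (pdLetter_eq_of_match (e := e) (i := 8) (j := 20) hm (4 * 2 ^ e + r) (by omega)
          (by omega) (by omega) (by omega)) (by decide)
    · exact absurd (key 2 (by omega)) (by decide)

/-- The long phrases inside a cycle have length `12 * 2 ^ e`. -/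
theorem LZEndChain.long {e r y : ℕ} {L : List ℕ}
    (h : LZEndChain ((y + 4 * 2 ^ e + 1) :: y :: L))
    (hy : y + r = 16 * 2 ^ e) (hr : 1 ≤ r) (hr' : r + 1 ≤ 3 * 2 ^ e) (hL : ∀ p ∈ L, p ≤ y) :
    LZEndChain ((y + 16 * 2 ^ e + 1) :: (y + 4 * 2 ^ e + 1) :: y :: L) := by
  have hpos : 0 < 2 ^ e := by positivity
  have := h.step (l := 12 * 2 ^ e - 1)
    ⟨y, by simp, y + 1 - 12 * 2 ^ e, by omega, fun s h1 h2 => ?_⟩ ?_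
  · convert this using 2; omega
  -- The source stays within positions up to `y < 16 * 2 ^ e`, so it contains no multiple of the
  -- shift `16 * 2 ^ e`.
  · have := pdLetter_add_two_pow_mul (e + 4) (y + 1 - 12 * 2 ^ e + s) 1 fun ⟨k, hk⟩ => by
      rw [pow_add, mul_assoc, mul_left_comm] at hk
      have h3 : 0 < k := by
        by_contra! hc
        interval_cases k; omega
      have := Nat.mul_le_mul_left (2 ^ e) h3
      omega
    rw [← this]
    congr 1
    rw [pow_add]
    omega
  · rintro p hp l ⟨x, hx, hm⟩
    by_contra! hl
    have hpy : p = y + 4 * 2 ^ e + 1 ∨ p ≤ y := by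
      rcases List.mem_cons.1 hp with rfl | hp
      · exact .inl rfl
      rcases List.mem_cons.1 hp with rfl | hp
      · exact .inr le_rfl
      · exact .inr (hL p hp)
    obtain ⟨q, hq⟩ := exists_eq_add_of_match (d := e + 2) (by omega)
      fun s h1 h2 => hm s h1 (by rw [pow_add] at h2; omega)
    rw [pow_add, mul_assoc] at hq
    have hq1 : q < 3 := by
      by_contra! hc
      have := Nat.mul_le_mul_left (2 ^ e) hc
      rw [show 2 ^ e * (2 ^ 2 * (2 * q)) = 8 * (2 ^ e * q) by ring] at hq
      omega
    -- Only `q = 2` remains, the source already used; extending it would compare letters 16 and 32.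
    interval_cases q <;> try omega
    exact absurd (pdLetter_eq_of_match (e := e) (i := 16) (j := 32) hm (12 * 2 ^ e + r - 1)
      (by omega) (by omega) (by omega) (by omega)) (by decide)

/-! ### The parse up to the first cycle -/

instance (p y l : ℕ) : Decidable (SuffixMatch p y l) :=
  decidable_of_iff (l ≤ p ∧ ∀ s < l, pdLetter (p - l + s + 1) = pdLetter (y + s + 1)) <| by
    constructor
    · rintro ⟨h, h'⟩
      refine ⟨p - l, by omega, fun s h1 h2 => ?_⟩
      have := h' (s - 1) (by omega)
      rwa [add_assoc, add_assoc, show s - 1 + 1 = s by omega] at this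
    · rintro ⟨x, rfl, h⟩
      refine ⟨by omega, fun s hs => ?_⟩
      rw [Nat.add_sub_cancel]
      exact h (s + 1) (by omega) (by omega)

/-- The parse `a|b|aa|aba|bab|aaabaa` of `S_4`, where the cycle with `e = 1` starts. -/
theorem lzEndChain_initial : LZEndChain [16, 10, 7, 4, 2, 1, 0] := by
  have step : ∀ (y l : ℕ) (L : List ℕ), LZEndChain (y :: L) →
      (∃ p ∈ y :: L, SuffixMatch p y l) →
      (∀ p ∈ y :: L, ∀ l' < p + 1, SuffixMatch p y l' → l' ≤ l) →
      LZEndChain ((y + l + 1) :: y :: L) := by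
    refine fun y l L h h1 h2 => h.step h1 fun p hp l' hm => h2 p hp l' ?_ hm
    obtain ⟨x, hx, -⟩ := hm
    omega
  refine step 10 5 _ (step 7 2 _ (step 4 2 _ (step 2 1 _ (step 1 0 _ (step 0 0 _ .base
    ?_ ?_) ?_ ?_) ?_ ?_) ?_ ?_) ?_ ?_) ?_ ?_
  all_goals decide

/-! ### Invariants along a cycle -/

/-- The phrase ends at the start of a cycle, where the phrases make up a whole period-doubling
sequence. -/
structure IsCycleStart (e : ℕ) (L : List ℕ) : Prop where
  chain : LZEndChain (8 * 2 ^ e :: 5 * 2 ^ e :: L)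
  le : ∀ p ∈ L, p ≤ 5 * 2 ^ e
  -- Throughout the cycle, the source of the extra last phrase (without its last letter) ends here.
  mem : 4 * 2 ^ e - 1 ∈ L

/-- The phrase ends `y :: L` inside a cycle, where the phrases make up a period-doubling sequence
without its last `3 * 2 ^ e - 1 - t` letters. -/
structure InCycle (e t y : ℕ) (L : List ℕ) : Prop where
  chain : LZEndChain (y :: L)
  lt : t < 3 * 2 ^ e
  add_eq : y + (3 * 2 ^ e - 1 - t) = 16 * 2 ^ (e + t)
  le : ∀ p ∈ L, p ≤ y
  -- Needed for the maximality of the short phrase.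
  gap : ∀ p ∈ L, 8 * 2 ^ (e + t) < p + (3 * 2 ^ e - 1 - t) → 8 * 2 ^ (e + t) ≤ p
  mem : 4 * 2 ^ e - 1 ∈ L

theorem IsCycleStart.inCycle {e : ℕ} {L : List ℕ} (h : IsCycleStart e L) :
    InCycle e 0 (13 * 2 ^ e + 1) (8 * 2 ^ e :: 5 * 2 ^ e :: L) := by
  have hpos : 0 < 2 ^ e := by positivity
  have hle := h.le
  refine ⟨h.chain.first h.le, by omega, by rw [add_zero]; omega, ?_, ?_, by simp [h.mem]⟩
  · simp only [List.mem_cons]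
    rintro p (rfl | rfl | hp)
    · omega
    · omega
    · have := hle p hp; omega
  · simp only [List.mem_cons, add_zero]
    rintro p (rfl | rfl | hp)
    · omega
    · omega
    · have := hle p hp; omega

theorem InCycle.succ {e t y : ℕ} {L : List ℕ} (h : InCycle e t y L) (ht : t + 1 < 3 * 2 ^ e) :
    InCycle e (t + 1) (y + 16 * 2 ^ (e + t) + 1) ((y + 4 * 2 ^ (e + t) + 1) :: y :: L) := by
  have hN : 2 ^ e ≤ 2 ^ (e + t) := Nat.pow_le_pow_right (by omega) (by omega)
  have hadd := h.add_eq
  have hle := h.le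
  have e1 : 2 ^ (e + (t + 1)) = 2 * 2 ^ (e + t) := by rw [← add_assoc, pow_succ']
  refine ⟨(h.chain.short hadd (by omega) (by omega) hle h.gap).long hadd (by omega) (by omega) hle,
    ht, by rw [e1]; omega, ?_, ?_, by simp [h.mem]⟩
  · simp only [List.mem_cons]
    rintro p (rfl | rfl | hp)
    · omega
    · omega
    · have := hle p hp; omega
  · rw [e1]
    simp only [List.mem_cons]
    rintro p (rfl | rfl | hp)
    · omega
    · omega
    · have := hle p hp; omega

theorem IsCycleStart.exists_inCycle {e : ℕ} {L : List ℕ} (h : IsCycleStart e L) :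
    ∀ t < 3 * 2 ^ e, ∃ y L', InCycle e t y L' ∧ L'.length = L.length + 2 + 2 * t := by
  intro t
  induction t with
  | zero => exact fun _ => ⟨_, _, h.inCycle, rfl⟩
  | succ t ih =>
    intro ht
    obtain ⟨y, L', h', hl⟩ := ih (by omega)
    exact ⟨_, _, h'.succ ht, by simp only [List.length_cons]; omega⟩

theorem IsCycleStart.next {e : ℕ} {L : List ℕ} (h : IsCycleStart e L) :
    ∃ L', IsCycleStart (e + 3 * 2 ^ e) L' ∧ L'.length + 1 = L.length + 6 * 2 ^ e := by
  have hpos : 0 < 2 ^ e := by positivity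
  -- At deficit 1, with `N = 2 ^ (e + t)`, the end is `y = 16 * N - 1` and the last two phrases end
  -- at `20 * N` and `32 * N`. With `4 * N` as the new power, these are the three ends a cycle start
  -- requires.
  obtain ⟨t, ht⟩ : ∃ t, 3 * 2 ^ e = t + 2 := ⟨3 * 2 ^ e - 2, by omega⟩
  obtain ⟨y, L', h', hl⟩ := h.exists_inCycle t (by omega)
  have hadd := h'.add_eq
  have e1 : 2 ^ (e + 3 * 2 ^ e) = 4 * 2 ^ (e + t) := by
    rw [ht, ← add_assoc, pow_succ, pow_succ]; ring
  refine ⟨y :: L', ⟨?_, ?_, ?_⟩, by simp only [List.length_cons]; omega⟩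
  · have := (h'.succ (by omega)).chain
    convert this using 2
    · rw [e1]; omega
    · congr 1; rw [e1]; omega
  · have hle := h'.le
    rw [e1]
    simp only [List.mem_cons]
    rintro p (rfl | hp)
    · omega
    · have := hle p hp; omega
  · rw [e1, List.mem_cons]
    left; omega

/-! ### Factorizations of the finite words -/

theorem IsCycleStart.lzEnd_eq {e : ℕ} {L : List ℕ} (h : IsCycleStart e L) :
    lzEnd (periodDoubling (e + 3)) = chainPhrases (8 * 2 ^ e :: 5 * 2 ^ e :: L) := by
  rw [← h.chain.lzEnd_eq, periodDoubling_eq_pdSegment, pow_add, mul_comm]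
  norm_num

theorem InCycle.lzEnd_eq {e t y : ℕ} {L : List ℕ} (h : InCycle e t y L)
    (ht : t + 1 < 3 * 2 ^ e) : lzEnd (periodDoubling (e + t + 4)) =
      chainPhrases (y :: L) ++ [pdSegment y (3 * 2 ^ e - 1 - t)] := by
  have hN : 2 ^ e ≤ 2 ^ (e + t) := Nat.pow_le_pow_right (by omega) (by omega)
  have hadd := h.add_eq
  obtain ⟨r, hr⟩ : ∃ r, 3 * 2 ^ e - 1 - t = r + 1 := ⟨3 * 2 ^ e - 1 - t - 1, by omega⟩
  rw [hr] at hadd ⊢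
  rw [periodDoubling_eq_pdSegment, pow_add, mul_comm, show 2 ^ 4 = 16 by rfl, ← hadd]
  refine h.chain.lzEnd_add ⟨4 * 2 ^ e - 1, List.mem_cons_of_mem _ h.mem,
    4 * 2 ^ e - 1 - r, by omega, fun s h1 h2 => ?_⟩
  -- The rest without its last letter stops just before `16 * 2 ^ (e + t)`, its source just before
  -- `4 * 2 ^ e`; their distance is this multiple of `2 ^ (e + 2)`.
  have := pdLetter_add_two_pow_mul (e + 2) (4 * 2 ^ e - 1 - r + s) (4 * 2 ^ t - 1) fun hd => by
    have := Nat.le_of_dvd (by omega) hd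
    rw [pow_add] at this
    omega
  rw [← this]
  congr 1
  rw [Nat.mul_sub, show 2 ^ (e + 2) * (4 * 2 ^ t) = 16 * 2 ^ (e + t) by ring,
    show 2 ^ (e + 2) * 1 = 4 * 2 ^ e by ring]
  omega

theorem InCycle.lzEnd_eq_last {e t y : ℕ} {L : List ℕ} (h : InCycle e t y L)
    (ht : t + 1 = 3 * 2 ^ e) : lzEnd (periodDoubling (e + t + 4)) = chainPhrases (y :: L) := by
  have hadd := h.add_eq
  rw [← h.chain.lzEnd_eq, periodDoubling_eq_pdSegment, pow_add 2 (e + t)]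
  congr 2
  omega

theorem InCycle.exists_lzEnd_eq_append {e t y : ℕ} {L : List ℕ} (h : InCycle e t y L) :
    ∃ Q, lzEnd (periodDoubling (e + t + 4)) = chainPhrases (y :: L) ++ Q := by
  rcases (show t + 1 ≤ 3 * 2 ^ e from h.lt).lt_or_eq with ht | ht
  · exact ⟨_, h.lzEnd_eq ht⟩
  · exact ⟨[], by rw [h.lzEnd_eq_last ht, List.append_nil]⟩

theorem IsCycleStart.lastPhraseKept {e : ℕ} {L : List ℕ} (h : IsCycleStart e L) (he : 1 ≤ e) :
    lastPhraseKept (e + 4) := by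
  refine ⟨by omega, ?_⟩
  obtain ⟨Q, hQ⟩ := h.inCycle.exists_lzEnd_eq_append
  have hlen := h.chain.length_chainPhrases
  have e1 : 13 * 2 ^ e + 1 = 8 * 2 ^ e + 5 * 2 ^ e + 1 := by ring
  rw [add_zero, e1, chainPhrases_step, List.append_assoc] at hQ
  rw [hQ, lzEndCount, show e + 4 - 1 = e + 3 by omega, h.lzEnd_eq, List.getLast?_eq_getElem?,
    List.getElem?_append_left (by rw [hlen]; simp)]

/-- The last phrase was truncated by the end of the word; in the next word a longer short phrase
takes its place. -/
theorem InCycle.not_lastPhraseKept {e t y : ℕ} {L : List ℕ} (h : InCycle e t y L)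
    (ht : t + 1 < 3 * 2 ^ e) : ¬ lastPhraseKept (e + t + 5) := by
  rintro ⟨-, hk⟩
  obtain ⟨Q, hQ⟩ := (h.succ ht).exists_lzEnd_eq_append
  rw [show y + 16 * 2 ^ (e + t) + 1 =
      y + 4 * 2 ^ (e + t) + 1 + (12 * 2 ^ (e + t) - 1) + 1 by
    have : 0 < 2 ^ (e + t) := by positivity
    omega, chainPhrases_step, chainPhrases_step, List.append_assoc, List.append_assoc] at hQ
  rw [show e + t + 5 - 1 = e + t + 4 by omega, show e + t + 5 = e + (t + 1) + 4 by ring, hQ,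
    lzEndCount, h.lzEnd_eq ht, List.length_append, List.length_singleton, Nat.add_sub_cancel,
    List.getElem?_append_right le_rfl] at hk
  simp only [Nat.sub_self, List.singleton_append, List.getElem?_cons_zero, List.getLast?_append,
    List.getLast?_singleton, Option.some_or, Option.some.injEq] at hk
  have := congrArg List.length hk
  rw [length_pdSegment, length_pdSegment] at this
  have hN : 2 ^ e ≤ 2 ^ (e + t) := Nat.pow_le_pow_right (by omega) (by omega)
  omega

/-! ### The set of cycle indices and the phrase counts -/

/-- The elements of the set of all `k` satisfying `lastPhraseKept k`, in increasing order. -/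
def cycleIndex : ℕ → ℕ
  | 0 => 5
  | i + 1 => cycleIndex i + 3 * 2 ^ (cycleIndex i - 4)

theorem cycleIndex_strictMono : StrictMono cycleIndex :=
  strictMono_nat_of_lt_succ fun i => by
    rw [cycleIndex]
    exact Nat.lt_add_of_pos_right (by positivity)

theorem five_le_cycleIndex (i : ℕ) : 5 ≤ cycleIndex i :=
  cycleIndex_strictMono.monotone (Nat.zero_le i)

theorem exists_isCycleStart (i : ℕ) :
    ∃ L, IsCycleStart (cycleIndex i - 4) L ∧ L.length + i + 5 = 2 * cycleIndex i := by
  induction i with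
  | zero => exact ⟨[7, 4, 2, 1, 0], ⟨lzEndChain_initial, by decide, by decide⟩, rfl⟩
  | succ i ih =>
    obtain ⟨L, h, hl⟩ := ih
    obtain ⟨L', h', hl'⟩ := h.next
    have := five_le_cycleIndex i
    refine ⟨L', ?_, ?_⟩
    · rw [cycleIndex]
      convert h' using 1
      omega
    · rw [cycleIndex]
      omega

theorem exists_cycleIndex_le {k : ℕ} (hk : 5 ≤ k) :
    ∃ i, cycleIndex i ≤ k ∧ k < cycleIndex (i + 1) := by
  induction k, hk using Nat.le_induction with
  | base => exact ⟨0, le_rfl, by decide⟩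
  | succ k hk ih =>
    obtain ⟨i, h1, h2⟩ := ih
    rcases (show k + 1 ≤ cycleIndex (i + 1) from h2).lt_or_eq with h | h
    · exact ⟨i, by omega, h⟩
    · exact ⟨i + 1, h.ge, by rw [h]; exact cycleIndex_strictMono (by omega)⟩

theorem lastPhraseKept_iff {k : ℕ} : lastPhraseKept k ↔ ∃ i, cycleIndex i = k := by
  constructor
  · intro h
    obtain ⟨i, h1, h2⟩ := exists_cycleIndex_le h.1
    refine ⟨i, h1.antisymm ?_⟩
    by_contra! hlt
    obtain ⟨L, hL, -⟩ := exists_isCycleStart i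
    rw [cycleIndex] at h2
    obtain ⟨y, L', h', -⟩ := hL.exists_inCycle (k - cycleIndex i - 1) (by omega)
    have h5 := five_le_cycleIndex i
    refine h'.not_lastPhraseKept (by omega) ?_
    convert h using 1
    omega
  · rintro ⟨i, rfl⟩
    obtain ⟨L, hL, -⟩ := exists_isCycleStart i
    have h5 := five_le_cycleIndex i
    have := hL.lastPhraseKept (by omega)
    rwa [show cycleIndex i - 4 + 4 = cycleIndex i by omega] at this

theorem kStar_succ (i : ℕ) : kStar (i + 1) = cycleIndex i := by
  have := Nat.nth_comp_of_strictMono (p := lastPhraseKept) (n := i) cycleIndex_strictMono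
    (fun k hk => lastPhraseKept_iff.1 hk) fun hfin => absurd hfin <|
      (Set.infinite_range_of_injective cycleIndex_strictMono.injective).mono <| by
        rintro _ ⟨j, rfl⟩
        exact lastPhraseKept_iff.2 ⟨j, rfl⟩
  rw [kStar, Nat.add_sub_cancel, ← this, Nat.nth_of_forall]
  exact fun j _ => lastPhraseKept_iff.2 ⟨j, rfl⟩

theorem lzEndCount_periodDoubling {i k : ℕ} (h1 : cycleIndex i ≤ k + 1)
    (h2 : k + 2 ≤ cycleIndex (i + 1)) : lzEndCount (periodDoubling k) + (i + 2) = 2 * k := by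
  obtain ⟨L, hL, hl⟩ := exists_isCycleStart i
  have h5 := five_le_cycleIndex i
  rcases h1.eq_or_lt with h | h
  · rw [lzEndCount, show k = cycleIndex i - 4 + 3 by omega, hL.lzEnd_eq,
      hL.chain.length_chainPhrases, List.length_cons]
    omega
  · rw [cycleIndex] at h2
    obtain ⟨y, L', h', hl'⟩ := hL.exists_inCycle (k - cycleIndex i) (by omega)
    rw [lzEndCount, show k = cycleIndex i - 4 + (k - cycleIndex i) + 4 by omega,
      h'.lzEnd_eq (by omega), List.length_append, h'.chain.length_chainPhrases,
      List.length_singleton]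
    omega

/-! ### Tower growth and the iterated logarithm -/

theorem two_pow_cycleIndex_le (i : ℕ) :
    2 ^ (cycleIndex i - 4) ≤ cycleIndex (i + 1) - 4 := by
  rw [cycleIndex]
  have := five_le_cycleIndex i
  omega

/-- One logarithm undoes at most one step of the tower of cycle parameters. -/
theorem le_of_iterate_logb_le_one (i : ℕ) : ∀ (x : ℝ) (N : ℕ), ((cycleIndex i - 4 : ℕ) : ℝ) ≤ x →
    (Real.logb 2)^[N] x ≤ 1 → i ≤ N := by
  induction i with
  | zero => intros; omega
  | succ i ih =>
    intro x N hx hN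
    have h2 : (2 : ℝ) ^ (cycleIndex i - 4) ≤ x := by
      refine le_trans ?_ hx
      exact_mod_cast two_pow_cycleIndex_le i
    have h5 := five_le_cycleIndex i
    have h1 : (2 : ℝ) ≤ x :=
      (le_self_pow₀ (by norm_num) (by omega)).trans h2
    rcases N with _ | N
    · simp at hN
      linarith
    · rw [Function.iterate_succ_apply] at hN
      have := ih (Real.logb 2 x) N (by
        rw [Real.le_logb_iff_rpow_le (by norm_num) (by linarith), Real.rpow_natCast]
        exact h2) hN
      omega

theorem le_logStar {i k : ℕ} (h : cycleIndex i ≤ k + 1) : i ≤ logStar k := by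
  classical
  have hs : (Real.logb 2)^[logStar k] k ≤ 1 := by
    unfold logStar
    exact Nat.find_spec (exists_iterate_logb_le_one (k : ℝ))
  refine le_of_iterate_logb_le_one i k _ ?_ hs
  exact_mod_cast (show cycleIndex i - 4 ≤ k by omega)

theorem theorem1 :
    ∃ f : ℕ → ℤ,
      (∀ k : ℕ, (lzEndCount (periodDoubling k) : ℤ) = 2 * (k : ℤ) - f k) ∧
      (fun k : ℕ => (f k : ℝ)) =O[atTop] (fun k : ℕ => (logStar (k : ℝ) : ℝ)) ∧
      (∀ k m : ℕ, 5 ≤ k → 1 ≤ m →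
        (kStar m : ℤ) - 1 ≤ (k : ℤ) → (k : ℤ) ≤ (kStar (m + 1) : ℤ) - 2 → f k = (m : ℤ) + 1) ∧
      kStar 1 = 5 ∧
      (∀ m : ℕ, 2 ≤ m →
        (kStar m : ℝ) = (kStar (m - 1) : ℝ) + 3 / 16 * (2 : ℝ) ^ kStar (m - 1)) := by
  refine ⟨fun k => 2 * (k : ℤ) - lzEndCount (periodDoubling k), fun k => by ring, ?_, ?_,
    kStar_succ 0, ?_⟩
  -- From `k = 10` on, `k + 1` has reached the second cycle index 11, so `i ≥ 1` and `f k = i + 2 ≤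
  -- 3 * i`.
  · refine IsBigO.of_bound 3 ?_
    filter_upwards [eventually_ge_atTop 10] with k hk
    obtain ⟨i, h1, h2⟩ := exists_cycleIndex_le (k := k + 1) (by omega)
    have hc := lzEndCount_periodDoubling h1 (by omega)
    have hi : 1 ≤ i := by
      by_contra! hi
      obtain rfl : i = 0 := by omega
      have : cycleIndex (0 + 1) = 11 := rfl
      omega
    have hle := le_logStar h1
    have e1 : 2 * (k : ℤ) - lzEndCount (periodDoubling k) = (i : ℤ) + 2 := by omega
    rw [e1, Real.norm_of_nonneg (by positivity), Real.norm_of_nonneg (by positivity)]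
    have h1' : (1 : ℝ) ≤ i := by exact_mod_cast hi
    have h2' : (i : ℝ) ≤ logStar k := by exact_mod_cast hle
    push_cast
    linarith
  · rintro k (_ | i) - hm h1 h2
    · omega
    · rw [kStar_succ] at h1 h2
      have := lzEndCount_periodDoubling (i := i) (k := k) (by omega) (by omega)
      show 2 * (k : ℤ) - lzEndCount (periodDoubling k) = _
      push_cast
      omega
  · intro m hm
    obtain ⟨i, rfl⟩ : ∃ i, m = i + 1 + 1 := ⟨m - 2, by omega⟩
    rw [Nat.add_sub_cancel, kStar_succ, kStar_succ, cycleIndex]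
    have h5 := five_le_cycleIndex i
    obtain ⟨c, hc⟩ : ∃ c, cycleIndex i = c + 4 := ⟨cycleIndex i - 4, by omega⟩
    rw [hc, Nat.add_sub_cancel]
    push_cast
    ring
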